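/- Let $\mathcal G$ be a strongly connected directed graph on $N\ge 1$ vertices with adjacency matrix $A=(a_{i,j})\in\{0,1\}^{N\times N}$, where $a_{i,j}=1$ if and only if there is an edge from $j$ to $i$ (self-loops are allowed unless stated otherwise). Put $d_i^{\rm in}=\sum_j a_{i,j}$, $d_j^{\rm out}=\sum_i a_{i,j}$, $D_{\rm in}=\mathrm{diag}(d_i^{\rm in})$, $D_{\rm out}=\mathrm{diag}(d_i^{\rm out})$, and let $L=D_{\rm in}^{-1/2}AD_{\rm out}^{-1/2}$ (if $N=1$ and there is no edge, $L=0$). For $x\in\mathbb R^{N\times K}$ with rows $x_1,\dots,x_N$, the Dirichlet energy is $$\mathfrak E(x)=\frac14\sum_{i,j=1}^N a_{i,j}\left\|\frac{x_i}{\sqrt{d_i^{\rm in}}}-\frac{x_j}{\sqrt{d_j^{\rm out}}}\right\|_2^2 .$$ For $M\in\mathbb R^{n\times n}$ denote its complex eigenvalues by $\lambda_1(M),\dots,\lambda_n(M)$, ordered so that $\operatorname{Re}\lambda_1(M)\le\dots\le\operatorname{Re}\lambda_n(M)$. Let $K\ge1$, let $W\in\mathbb R^{K\times K}$ be a diagonal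 matrix, and consider the heat equation (with $\alpha=1$) $$x'(t)=-L\,x(t)\,W\quad(t\ge 0),\qquad x(0)=x_0\in\mathbb R^{N\times K}.$$ With $\|\cdot\|_2$ the Frobenius norm, a solution $x$ is called highest-frequency-dominant (HFD) if $\mathfrak E(x(t)/\|x(t)\|_2)\to\frac12\operatorname{Re}\lambda_N(I-L)$ as $t\to\infty$, and lowest-frequency-dominant (LFD) if $\mathfrak E(x(t)/\|x(t)\|_2)\to\frac12\operatorname{Re}\lambda_1(I-L)$ as $t\to\infty$. Then $\lambda_N(L)$ is real, and the following hold. 1. Suppose that $\lambda_1(L)$ is the only eigenvalue of $L$ (as a complex number, not counting multiplicity) whose real part is minimal. If $\lambda_K(W)\operatorname{Re}\lambda_1(L)<\lambda_1(W)\lambda_N(L)$, then for almost all $x_0\in\mathbb R^{N\times K}$ (with respect to Lebesgue measure) the initial value problem has a solution and every solution of it is HFD. 2. Suppose that $\mathcal G$ has no self-loops or, alternatively, that $\operatorname{Re}\lambda_1(L)\le 0$. If $\lambda_K(W)\operatorname{Re}\lambda_1(L)>\lambda_1(W)\lambda_N(L)$, then for almost all $x_0\in\mathbb R^{N\times K}$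 the initial value problem has a solution and every solution of it is LFD. -/

import Mathlib

open Filter Topology MeasureTheory

noncomputable section

namespace FracGraph

/-- A digraph is strongly connected if every vertex can be reached from every vertex
along a directed path. -/
def StronglyConnected {V : Type*} (G : Digraph V) : Prop :=
  ∀ i j : V, Relation.ReflTransGen G.Adj i j

open Classical in
/-- Adjacency matrix, `a i j = 1` if there is an edge directed from `j` to `i`, else `0`. -/
def adj {N : ℕ} (G : Digraph (Fin N)) : Matrix (Fin N) (Fin N) ℝ :=
  Matrix.of fun i j => if G.Adj j i then 1 else 0

/-- In-degrees, the diagonal of `diag (A 1)`. -/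
def inDeg {N : ℕ} (G : Digraph (Fin N)) (i : Fin N) : ℝ := ∑ j, adj G i j

/-- Out-degrees, the diagonal of `diag (Aᵀ 1)`. -/
def outDeg {N : ℕ} (G : Digraph (Fin N)) (j : Fin N) : ℝ := ∑ i, adj G i j

/-- The symmetrically normalized adjacency `L = D_in ^ (-1/2) * A * D_out ^ (-1/2)`. -/
def sna {N : ℕ} (G : Digraph (Fin N)) : Matrix (Fin N) (Fin N) ℝ :=
  Matrix.diagonal (fun i => (√(inDeg G i))⁻¹) * adj G *
    Matrix.diagonal (fun j => (√(outDeg G j))⁻¹)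

/-- The symmetrically normalized Laplacian `I - L`. -/
def snl {N : ℕ} (G : Digraph (Fin N)) : Matrix (Fin N) (Fin N) ℝ := 1 - sna G

/-- The Dirichlet energy of node features `x`. -/
def dirichletEnergy {N K : ℕ} (G : Digraph (Fin N)) (x : Matrix (Fin N) (Fin K) ℝ) : ℝ :=
  (1 / 4) * ∑ i, ∑ j, adj G i j *
    ∑ k, (x i k / √(inDeg G i) - x j k / √(outDeg G j)) ^ 2

/-- The Frobenius norm. -/
def frob {N K : ℕ} (x : Matrix (Fin N) (Fin K) ℝ) : ℝ := √(∑ i, ∑ k, x i k ^ 2)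

/-- The normalized features `x / ‖x‖₂` (Frobenius norm). -/
def normalized {N K : ℕ} (x : Matrix (Fin N) (Fin K) ℝ) : Matrix (Fin N) (Fin K) ℝ :=
  (frob x)⁻¹ • x

/-- The set of complex eigenvalues of a real square matrix. -/
def eigenvalues {n : ℕ} (M : Matrix (Fin n) (Fin n) ℝ) : Set ℂ :=
  spectrum ℂ (M.map (fun a : ℝ => (a : ℂ)))

/-- `μ` is a first eigenvalue `λ₁(M)` in the ascending order of real parts. -/
def IsLowestEigenvalue {n : ℕ} (M : Matrix (Fin n) (Fin n) ℝ) (μ : ℂ) : Prop :=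
  μ ∈ eigenvalues M ∧ ∀ ν ∈ eigenvalues M, μ.re ≤ ν.re

/-- `μ` is a last eigenvalue `λₙ(M)` in the ascending order of real parts. -/
def IsHighestEigenvalue {n : ℕ} (M : Matrix (Fin n) (Fin n) ℝ) (μ : ℂ) : Prop :=
  μ ∈ eigenvalues M ∧ ∀ ν ∈ eigenvalues M, ν.re ≤ μ.re

/-- `x` solves the heat equation `x'(t) = - L x(t) W` for `t ≥ 0` (one-sided derivative
at `t = 0`) with initial value `x(0) = x₀`. -/
def IsHeatSolution {N K : ℕ} (G : Digraph (Fin N)) (W : Matrix (Fin K) (Fin K) ℝ)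
    (x₀ : Matrix (Fin N) (Fin K) ℝ) (x : ℝ → Matrix (Fin N) (Fin K) ℝ) : Prop :=
  x 0 = x₀ ∧ ∀ t : ℝ, 0 ≤ t → ∀ i k,
    HasDerivWithinAt (fun s => x s i k) ((-(sna G * x t * W)) i k) (Set.Ici 0) t

/-- `lam`-frequency-dominance: the normalized Dirichlet energy tends to `lam / 2`. -/
def IsFreqDominant {N K : ℕ} (G : Digraph (Fin N)) (x : ℝ → Matrix (Fin N) (Fin K) ℝ)
    (lam : ℝ) : Prop :=
  Tendsto (fun t => dirichletEnergy G (normalized (x t))) atTop (𝓝 (lam / 2))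

/-- Lowest-frequency-dominance: `Re λ₁(I - L)`-frequency-dominance. -/
def IsLFD {N K : ℕ} (G : Digraph (Fin N)) (x : ℝ → Matrix (Fin N) (Fin K) ℝ) : Prop :=
  ∃ μ : ℂ, IsLowestEigenvalue (snl G) μ ∧ IsFreqDominant G x μ.re

/-- Highest-frequency-dominance: `Re λ_N(I - L)`-frequency-dominance. -/
def IsHFD {N K : ℕ} (G : Digraph (Fin N)) (x : ℝ → Matrix (Fin N) (Fin K) ℝ) : Prop :=
  ∃ μ : ℂ, IsHighestEigenvalue (snl G) μ ∧ IsFreqDominant G x μ.re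

end FracGraph

end

/-! ### Perron–Frobenius theory: the rightmost eigenvalue of a nonnegative matrix. -/

noncomputable section

namespace FracGraph

open Matrix

/-! Since `W` is diagonal, the columns decouple: column `k` solves `y' = -w k • L y`, and an
eigenvalue `μ` of `L` contributes growth rate `-w k * Re μ`. On the energy side, `E(x) = (‖x‖² - ⟨x,
L x⟩) / 2`, so the normalized energy tends to `(1 - r) / 2` as soon as `(L - r) x = o(‖x‖)`. It
remains to show that solutions asymptotically point into one eigenspace (`ae_isFreqDominant`).

Columns with `w k > 0` favour `λ₁`, those with `w k < 0` favour `λ_N`. The strict inequality between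
`λ_K(W) Re λ₁(L)` and `λ₁(W) λ_N(L)` says which extreme pair grows faster. Columns of the winning
sign each align with the right eigenspace, so they need no comparison with one another; every other
column is negligible against the fastest winning one. Jordan blocks do no harm: after division by
the leading power of `t` and the exponential, the limit is a genuine eigenvector
(`IsLinearSolution.dominant`). The required nonzero component is missing only on a proper real
subspace of initial values, a null set.

Perron–Frobenius makes `λ_N` real, nonnegative and alone on its vertical line. For `λ₁`, uniqueness
is a hypothesis and reality follows by conjugation. In the second claim `Re λ₁ ≤ 0` is also needed;
without self-loops it follows from `tr L = 0`. -/

/-- Powers of an element of a Banach algebra are dominated by powers of any number larger than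
the spectral radius. -/
theorem tendsto_norm_pow_div_pow {A : Type*} [NormedRing A] [NormedAlgebra ℂ A] [CompleteSpace A]
    (a : A) (s : NNReal) (h : spectralRadius ℂ a < s) :
    Tendsto (fun k : ℕ => ‖a ^ k‖ / (s : ℝ) ^ k) atTop (𝓝 0) := by
  obtain ⟨r, hr, hrs⟩ := ENNReal.lt_iff_exists_nnreal_btwn.1 h
  have hrs : r < s := by exact_mod_cast hrs
  have hs : (0 : ℝ) < s := lt_of_le_of_lt r.2 (by exact_mod_cast hrs)
  have hg : Tendsto (fun k : ℕ => ((r : ℝ) / s) ^ k) atTop (𝓝 0) :=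
    tendsto_pow_atTop_nhds_zero_of_lt_one (by positivity)
      ((div_lt_one hs).2 (by exact_mod_cast hrs))
  refine squeeze_zero' (Eventually.of_forall fun k => by positivity) ?_ hg
  filter_upwards [(spectrum.pow_nnnorm_pow_one_div_tendsto_nhds_spectralRadius a).eventually_lt_const
    hr, eventually_gt_atTop 0] with k hk hk0
  have h2 : (‖a ^ k‖₊ : ENNReal) ≤ (r : ENNReal) ^ k := by
    have := pow_le_pow_left' hk.le k
    rwa [← ENNReal.rpow_natCast, ← ENNReal.rpow_mul, one_div,
      inv_mul_cancel₀ (by positivity), ENNReal.rpow_one] at this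
  have h3 : ‖a ^ k‖ ≤ (r : ℝ) ^ k := by exact_mod_cast h2
  rw [div_pow]
  gcongr

section

attribute [local instance] Matrix.linftyOpNormedRing Matrix.linftyOpNormedAlgebra

/-- For `s` above the spectral radius `ρ` of a complex matrix, `(M / s) ^ k → 0` entrywise. -/
theorem exists_spectralRadius {n : Type*} [Fintype n] [DecidableEq n] [Nonempty n]
    (M : Matrix n n ℂ) :
    ∃ l ∈ spectrum ℂ M, (∀ m ∈ spectrum ℂ M, ‖m‖ ≤ ‖l‖) ∧ ∀ s : ℝ, ‖l‖ < s → ∀ i j,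
      Tendsto (fun k : ℕ => ‖(M ^ k) i j‖ / s ^ k) atTop (𝓝 0) := by
  obtain ⟨l, hl, hr⟩ := spectrum.exists_nnnorm_eq_spectralRadius M
  refine ⟨l, hl, fun m hm => ?_, fun s hs i j => ?_⟩
  · have : (‖m‖₊ : ENNReal) ≤ spectralRadius ℂ M :=
      le_iSup₂ (f := fun (k : ℂ) (_ : k ∈ spectrum ℂ M) => (‖k‖₊ : ENNReal)) m hm
    rw [← hr] at this
    exact_mod_cast this
  · have hs0 : 0 ≤ s := (norm_nonneg l).trans hs.le
    lift s to NNReal using hs0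
    have h := tendsto_norm_pow_div_pow M s (by rw [← hr]; exact_mod_cast hs)
    refine squeeze_zero (fun k => by positivity) (fun k => ?_) h
    gcongr
    have h1 : ‖(M ^ k) i j‖₊ ≤ ‖M ^ k‖₊ := by
      rw [Matrix.linfty_opNNNorm_def]
      exact (Finset.single_le_sum (f := fun j => ‖(M ^ k) i j‖₊) (fun _ _ => zero_le)
        (Finset.mem_univ j)).trans
        (Finset.le_sup (f := fun i => ∑ j, ‖(M ^ k) i j‖₊) (Finset.mem_univ i))
    exact_mod_cast h1

end

theorem mulVec_nonneg_mono {n : Type*} [Fintype n] {M : Matrix n n ℝ} (hM : ∀ i j, 0 ≤ M i j)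
    {p q : n → ℝ} (h : p ≤ q) : M *ᵥ p ≤ M *ᵥ q := fun i =>
  Finset.sum_le_sum fun j _ => mul_le_mul_of_nonneg_left (h j) (hM i j)

theorem map_ofReal_mulVec {m n : Type*} [Fintype n] (M : Matrix m n ℝ) (v : n → ℝ) :
    M.map (fun a : ℝ => (a : ℂ)) *ᵥ (fun i => (v i : ℂ)) = fun i => ((M *ᵥ v) i : ℂ) := by
  ext i
  simp [mulVec, dotProduct]

theorem map_ofReal_pow {n : Type*} [Fintype n] [DecidableEq n] (M : Matrix n n ℝ) (k : ℕ) :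
    M.map (fun a : ℝ => (a : ℂ)) ^ k = (M ^ k).map (fun a : ℝ => (a : ℂ)) :=
  (Matrix.map_pow (f := Complex.ofRealHom) M k).symm

theorem exists_mulVec_eq_smul {n : Type*} [Fintype n] [DecidableEq n] {M : Matrix n n ℂ} {l : ℂ}
    (hl : l ∈ spectrum ℂ M) : ∃ u : n → ℂ, u ≠ 0 ∧ M *ᵥ u = l • u := by
  rw [← Matrix.spectrum_toLin', ← Module.End.hasEigenvalue_iff_mem_spectrum] at hl
  obtain ⟨u, hu⟩ := hl.exists_hasEigenvector
  exact ⟨u, hu.2, by simpa using hu.apply_eq_smul⟩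

theorem det_ne_zero_of_notMem_spectrum {n : Type*} [Fintype n] [DecidableEq n]
    {M : Matrix n n ℝ} {s : ℝ} (hs : (s : ℂ) ∉ spectrum ℂ (M.map (fun a : ℝ => (a : ℂ)))) :
    (s • (1 : Matrix n n ℝ) - M).det ≠ 0 := by
  intro h
  obtain ⟨v, hv, h⟩ := Matrix.exists_mulVec_eq_zero_iff.2 h
  refine hs ?_
  rw [← Matrix.spectrum_toLin', ← Module.End.hasEigenvalue_iff_mem_spectrum]
  refine Module.End.hasEigenvalue_of_hasEigenvector (x := fun i => (v i : ℂ))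
    ⟨Module.End.mem_eigenspace_iff.2 ?_, fun h0 => hv ?_⟩
  · rw [sub_mulVec, smul_mulVec, one_mulVec, sub_eq_zero] at h
    rw [Matrix.toLin'_apply, map_ofReal_mulVec, ← h]
    ext i
    simp
  · ext i
    simpa using congrFun h0 i

/-- If `M` is nonnegative and `M p ≥ r p` with `p ≥ 0`, then for `s` such that `(M / s) ^ k → 0`
the vector `(s - M)⁻¹ p` dominates the truncated geometric series. -/
theorem geom_sum_smul_le {n : Type*} [Fintype n] [DecidableEq n] {M : Matrix n n ℝ}
    (hM : ∀ i j, 0 ≤ M i j) {p q : n → ℝ} {r s : ℝ} (hr : 0 ≤ r) (hs : 0 < s) (hp : 0 ≤ p)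
    (hMp : r • p ≤ M *ᵥ p) (hq : (s • (1 : Matrix n n ℝ) - M) *ᵥ q = p)
    (h0 : ∀ i j, Tendsto (fun k : ℕ => (M ^ k) i j / s ^ k) atTop (𝓝 0)) (m : ℕ) (i : n) :
    (∑ k ∈ Finset.range m, r ^ k / s ^ (k + 1)) * p i ≤ q i := by
  have hMq : M *ᵥ q = s • q - p := by
    rw [← hq, sub_mulVec, smul_mulVec, one_mulVec, sub_sub_cancel]
  have hpow : ∀ k : ℕ, r ^ k • p ≤ M ^ k *ᵥ p := by
    intro k
    induction k with
    | zero => simp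
    | succ k ih =>
      calc r ^ (k + 1) • p = r ^ k • (r • p) := by rw [pow_succ, mul_smul]
        _ ≤ r ^ k • (M *ᵥ p) := smul_le_smul_of_nonneg_left hMp (by positivity)
        _ = M *ᵥ (r ^ k • p) := by rw [mulVec_smul]
        _ ≤ M *ᵥ (M ^ k *ᵥ p) := mulVec_nonneg_mono hM ih
        _ = M ^ (k + 1) *ᵥ p := by rw [mulVec_mulVec, pow_succ']
  -- This is `q = (p + M q) / s` substituted into itself `k` times; the remainder vanishes in the
  -- limit.
  have hexp : ∀ k : ℕ, q i = (∑ l ∈ Finset.range k, (M ^ l *ᵥ p) i / s ^ (l + 1))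
      + (M ^ k *ᵥ q) i / s ^ k := by
    intro k
    induction k with
    | zero => simp
    | succ k ih =>
      rw [Finset.sum_range_succ, ih, pow_succ M, ← mulVec_mulVec, hMq, mulVec_sub, mulVec_smul]
      simp only [Pi.sub_apply, Pi.smul_apply, smul_eq_mul]
      field_simp
      ring
  have hlim : Tendsto (fun k : ℕ => (M ^ k *ᵥ q) i / s ^ k) atTop (𝓝 0) := by
    have : Tendsto (fun k : ℕ => ∑ j, (M ^ k) i j / s ^ k * q j) atTop (𝓝 (∑ j, 0 * q j)) :=
      tendsto_finsetSum _ fun j _ => (h0 i j).mul_const _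
    simp only [zero_mul, Finset.sum_const_zero] at this
    refine this.congr fun k => ?_
    simp only [mulVec, dotProduct, Finset.sum_div]
    exact Finset.sum_congr rfl fun j _ => by ring
  have hle : ∀ᶠ k : ℕ in atTop,
      (∑ k ∈ Finset.range m, r ^ k / s ^ (k + 1)) * p i + (M ^ k *ᵥ q) i / s ^ k ≤ q i := by
    filter_upwards [eventually_ge_atTop m] with k hk
    rw [hexp k]
    refine add_le_add ?_ le_rfl
    rw [Finset.sum_mul]
    have hterm : ∀ l, r ^ l / s ^ (l + 1) * p i ≤ (M ^ l *ᵥ p) i / s ^ (l + 1) := fun l => by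
      rw [div_mul_eq_mul_div]
      exact div_le_div_of_nonneg_right (hpow l i) (by positivity)
    refine (Finset.sum_le_sum fun l _ => hterm l).trans
      (Finset.sum_le_sum_of_subset_of_nonneg (Finset.range_mono hk) fun l _ _ => ?_)
    refine le_trans ?_ (hterm l)
    have := hp i
    simp only [Pi.zero_apply] at this
    positivity
  have := le_of_tendsto (hlim.const_add _) hle
  simpa using this

/-- **Perron–Frobenius**, weak form: the spectral radius of a nonnegative matrix is an
eigenvalue. -/
theorem exists_perron_eigenvalue {n : Type*} [Fintype n] [DecidableEq n] [Nonempty n]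
    {M : Matrix n n ℝ} (hM : ∀ i j, 0 ≤ M i j) :
    ∃ r : ℝ, 0 ≤ r ∧ (r : ℂ) ∈ spectrum ℂ (M.map (fun a : ℝ => (a : ℂ))) ∧
      ∀ l ∈ spectrum ℂ (M.map (fun a : ℝ => (a : ℂ))), ‖l‖ ≤ r := by
  obtain ⟨l, hl, hmax, hpow⟩ := exists_spectralRadius (M.map (fun a : ℝ => (a : ℂ)))
  refine ⟨‖l‖, norm_nonneg _, ?_, hmax⟩
  by_contra hnot
  have hr : 0 < ‖l‖ := by
    refine norm_pos_iff.2 fun h => hnot ?_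
    rw [h] at hl ⊢
    simpa using hl
  obtain ⟨u, hu, hlu⟩ := exists_mulVec_eq_smul hl
  set p : n → ℝ := fun i => ‖u i‖
  have hMp : ‖l‖ • p ≤ M *ᵥ p := by
    intro i
    have := congrFun hlu i
    calc ‖l‖ * ‖u i‖ = ‖(M.map (fun a : ℝ => (a : ℂ)) *ᵥ u) i‖ := by
          rw [this, Pi.smul_apply, smul_eq_mul, norm_mul]
      _ ≤ ∑ j, ‖(M i j : ℂ) * u j‖ := norm_sum_le _ _
      _ = (M *ᵥ p) i := Finset.sum_congr rfl fun j _ => by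
          rw [norm_mul, Complex.norm_real, Real.norm_of_nonneg (hM i j)]
  obtain ⟨i, hi⟩ := Function.ne_iff.1 hu
  have hpi : 0 < p i := norm_pos_iff.2 hi
  set q : ℝ → n → ℝ := fun s => (s • (1 : Matrix n n ℝ) - M)⁻¹ *ᵥ p
  have hdet : (‖l‖ • (1 : Matrix n n ℝ) - M).det ≠ 0 := det_ne_zero_of_notMem_spectrum hnot
  have hcont : Continuous fun s : ℝ => s • (1 : Matrix n n ℝ) - M := by fun_prop
  have hq : ContinuousAt (fun s => q s i) ‖l‖ := by
    have h1 : ContinuousAt (fun s : ℝ => (s • (1 : Matrix n n ℝ) - M)⁻¹) ‖l‖ := by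
      simp only [Matrix.inv_def, Ring.inverse_eq_inv']
      exact (hcont.matrix_det.continuousAt.inv₀ hdet).smul hcont.matrix_adjugate.continuousAt
    have h2 : Continuous fun B : Matrix n n ℝ => (B *ᵥ p) i := by fun_prop
    exact h2.continuousAt.comp h1
  -- If `‖l‖` were not an eigenvalue, the resolvent would be continuous there. As `s` decreases to
  -- `‖l‖`, each of the `m` terms of the geometric sum tends to `1 / ‖l‖`, so the finite value `q
  -- ‖l‖ i` would exceed every bound.
  have key : ∀ m : ℕ, (m : ℝ) * (p i / ‖l‖) ≤ q ‖l‖ i := by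
    intro m
    have hev : ∀ᶠ s in 𝓝[>] ‖l‖,
        (∑ k ∈ Finset.range m, ‖l‖ ^ k / s ^ (k + 1)) * p i ≤ q s i := by
      have hd : ∀ᶠ s in 𝓝[>] ‖l‖, (s • (1 : Matrix n n ℝ) - M).det ≠ 0 :=
        (hcont.matrix_det.continuousAt.eventually_ne hdet).filter_mono nhdsWithin_le_nhds
      filter_upwards [hd, self_mem_nhdsWithin] with s hs hls
      refine geom_sum_smul_le hM hr.le (hr.trans hls) (fun i => norm_nonneg _) hMp ?_ ?_ m i
      · rw [mulVec_mulVec, Matrix.mul_nonsing_inv _ (isUnit_iff_ne_zero.2 hs), one_mulVec]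
      · intro a b
        rw [tendsto_zero_iff_norm_tendsto_zero]
        refine (hpow s hls a b).congr fun k => ?_
        rw [map_ofReal_pow, Matrix.map_apply, Complex.norm_real, norm_div, norm_pow,
          Real.norm_of_nonneg (hr.trans hls).le]
    have hl1 : Tendsto (fun s : ℝ => (∑ k ∈ Finset.range m, ‖l‖ ^ k / s ^ (k + 1)) * p i)
        (𝓝[>] ‖l‖) (𝓝 ((∑ k ∈ Finset.range m, ‖l‖ ^ k / ‖l‖ ^ (k + 1)) * p i)) := by
      refine Tendsto.mul_const _ (tendsto_finsetSum _ fun k _ => ?_)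
      refine Tendsto.div tendsto_const_nhds ?_ (by positivity)
      exact ((continuous_pow (k + 1)).tendsto _).mono_left nhdsWithin_le_nhds
    have := le_of_tendsto_of_tendsto hl1 (hq.tendsto.mono_left nhdsWithin_le_nhds) hev
    have hterm : ∀ k ∈ Finset.range m, ‖l‖ ^ k / ‖l‖ ^ (k + 1) = ‖l‖⁻¹ := fun k _ => by
      field_simp
      ring
    rw [Finset.sum_congr rfl hterm, Finset.sum_const, Finset.card_range, nsmul_eq_mul] at this
    rwa [div_eq_inv_mul, ← mul_assoc]
  obtain ⟨m, hm⟩ := exists_nat_gt (q ‖l‖ i / (p i / ‖l‖))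
  rw [div_lt_iff₀ (by positivity)] at hm
  exact absurd (key m) (not_le.2 hm)

/-- The eigenvalue of largest real part of a nonnegative matrix is its spectral radius. -/
theorem highest_eq_of_nonneg {n : ℕ} [NeZero n] {M : Matrix (Fin n) (Fin n) ℝ}
    (hM : ∀ i j, 0 ≤ M i j) {l : ℂ} (hl : IsHighestEigenvalue M l) :
    l.im = 0 ∧ 0 ≤ l.re ∧ ∀ m ∈ eigenvalues M, m.re = l.re → m = l := by
  obtain ⟨r, hr, hrm, hmax⟩ := exists_perron_eigenvalue hM
  -- The disc of radius `r` meets the half-plane `Re ≥ r` only at `r`.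
  have key : ∀ m ∈ eigenvalues M, r ≤ m.re → m = r := by
    intro m hm h
    have h1 : m.re = r := le_antisymm ((Complex.re_le_norm m).trans (hmax m hm)) h
    have h2 : ‖m‖ = r := le_antisymm (hmax m hm) (h.trans (Complex.re_le_norm m))
    have h3 := Complex.sq_norm m
    rw [Complex.normSq_apply, h2, h1] at h3
    refine Complex.ext (by simpa using h1) ?_
    simp only [Complex.ofReal_im]
    nlinarith
  have hlr : r ≤ l.re := by simpa using hl.2 r hrm
  have h := key l hl.1 hlr
  refine ⟨by simp [h], by simpa [h] using hr, fun m hm h' => ?_⟩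
  rw [h, key m hm (by rw [h']; exact hlr)]

/-- If the trace vanishes, some eigenvalue has nonpositive real part. -/
theorem lowest_re_nonpos_of_trace_eq_zero {n : ℕ} [NeZero n] {M : Matrix (Fin n) (Fin n) ℝ}
    (hM : M.trace = 0) {l : ℂ} (hl : IsLowestEigenvalue M l) : l.re ≤ 0 := by
  set C : Matrix (Fin n) (Fin n) ℂ := M.map (fun a : ℝ => (a : ℂ))
  have hC : C.trace = 0 := by
    have : C.trace = (M.trace : ℂ) := by simp [Matrix.trace, C]
    rw [this, hM, Complex.ofReal_zero]
  rw [Matrix.trace_eq_sum_roots_charpoly] at hC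
  have hcard : Multiset.card C.charpoly.roots = n := by
    have h := (IsAlgClosed.splits C.charpoly).natDegree_eq_card_roots
    rw [Matrix.charpoly_natDegree_eq_dim, Fintype.card_fin] at h
    exact h.symm
  have h1 : (C.charpoly.roots.map Complex.re).sum = 0 := by
    have := map_multiset_sum Complex.reAddGroupHom C.charpoly.roots
    rw [hC] at this
    simpa using this.symm
  have h2 : Multiset.card (C.charpoly.roots.map Complex.re) • l.re
      ≤ (C.charpoly.roots.map Complex.re).sum := by
    refine Multiset.card_nsmul_le_sum fun x hx => ?_
    obtain ⟨m, hm, rfl⟩ := Multiset.mem_map.1 hx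
    exact hl.2 m (Matrix.mem_spectrum_iff_isRoot_charpoly.2 (Polynomial.isRoot_of_mem_roots hm))
  rw [h1, Multiset.card_map, hcard, nsmul_eq_mul] at h2
  have : (0 : ℝ) < n := by exact_mod_cast Nat.pos_of_ne_zero (NeZero.ne n)
  nlinarith

end FracGraph

end

/-! ### Growth and direction of solutions of linear systems with constant coefficients. -/

noncomputable section

namespace FracGraph

open Asymptotics Module.End
open scoped Nat

section LinearODE

variable {ι : Type*}

/-- `y` solves `y' = a f(y)` on `[0, ∞)`. -/
def IsLinearSolution [Fintype ι] (f : Module.End ℂ (ι → ℂ)) (a : ℝ) (y : ℝ → ι → ℂ) : Prop :=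
  ∀ t : ℝ, 0 ≤ t → HasDerivWithinAt y ((a : ℂ) • f (y t)) (Set.Ici 0) t

theorem IsLinearSolution.add [Fintype ι] {f : Module.End ℂ (ι → ℂ)} {a : ℝ} {y z : ℝ → ι → ℂ}
    (hy : IsLinearSolution f a y) (hz : IsLinearSolution f a z) :
    IsLinearSolution f a (y + z) := fun t ht => by
  simpa only [Pi.add_apply, map_add, smul_add] using (hy t ht).add (hz t ht)

theorem IsLinearSolution.eq_of_eq_zero [Fintype ι] {f : Module.End ℂ (ι → ℂ)} {a : ℝ} {y z : ℝ → ι → ℂ}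
    (hy : IsLinearSolution f a y) (hz : IsLinearSolution f a z) (h0 : y 0 = z 0) {t : ℝ}
    (ht : 0 ≤ t) : y t = z t := by
  set F : (ι → ℂ) →L[ℂ] (ι → ℂ) := LinearMap.toContinuousLinearMap ((a : ℂ) • f)
  have aux : ∀ {w : ℝ → ι → ℂ}, IsLinearSolution f a w → ContinuousOn w (Set.Icc 0 t) ∧
      ∀ s ∈ Set.Ico 0 t, HasDerivWithinAt w (F (w s)) (Set.Ici s) s := fun {w} hw =>
    ⟨fun s hs => ((hw s hs.1).continuousWithinAt).mono Set.Icc_subset_Ici_self,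
      fun s hs => (hw s hs.1).mono (Set.Ici_subset_Ici.2 hs.1)⟩
  exact ODE_solution_unique (v := fun _ => F) (K := ‖F‖₊) (fun _ => F.lipschitz)
    (aux hy).1 (aux hy).2 (aux hz).1 (aux hz).2 h0 ⟨ht, le_rfl⟩

theorem hasDerivAt_sum_pow_div_factorial_smul [Fintype ι] (w : ℕ → ι → ℂ) (n : ℕ) (s : ℂ) :
    HasDerivAt (fun s : ℂ => ∑ k ∈ Finset.range (n + 1), (s ^ k / (k ! : ℂ)) • w k)
      (∑ k ∈ Finset.range n, (s ^ k / (k ! : ℂ)) • w (k + 1)) s := by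
  induction n with
  | zero => simpa using hasDerivAt_const s (w 0)
  | succ n ih =>
    simp only [Finset.sum_range_succ _ (n + 1)]
    rw [Finset.sum_range_succ]
    refine ih.add ?_
    have h := (((hasDerivAt_pow (n + 1) s).div_const ((n + 1)! : ℂ)).smul_const (w (n + 1)))
    convert h using 2
    have : (n ! : ℂ) ≠ 0 := by exact_mod_cast n.factorial_ne_zero
    have : (n : ℂ) + 1 ≠ 0 := by exact_mod_cast n.succ_ne_zero
    rw [Nat.factorial_succ, Nat.add_sub_cancel]
    push_cast
    field_simp

/-- The solution `e ^ (s f) v` of `y' = f(y)` for a generalized eigenvector `v` of `f`. -/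
def mode (f : Module.End ℂ (ι → ℂ)) (μ : ℂ) (n : ℕ) (v : ι → ℂ) (s : ℂ) : ι → ℂ :=
  Complex.exp (s * μ) •
    ∑ k ∈ Finset.range (n + 1), (s ^ k / (k ! : ℂ)) • ((f - μ • 1) ^ k) v

theorem mode_zero (f : Module.End ℂ (ι → ℂ)) (μ : ℂ) (n : ℕ) (v : ι → ℂ) :
    mode f μ n v 0 = v := by
  rw [mode, Finset.sum_range_succ']
  simp

/-- Differentiating the polynomial factor shifts every power of `f - μ` up by one; the power that
this truncation misses is `n + 1`, which kills `v`. -/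
theorem hasDerivAt_mode [Fintype ι] {f : Module.End ℂ (ι → ℂ)} {μ : ℂ} {n : ℕ} {v : ι → ℂ}
    (hv : ((f - μ • 1) ^ (n + 1)) v = 0) (s : ℂ) :
    HasDerivAt (mode f μ n v) (f (mode f μ n v s)) s := by
  have h1 : HasDerivAt (fun s : ℂ => Complex.exp (s * μ)) (Complex.exp (s * μ) * μ) s := by
    simpa using ((hasDerivAt_id s).mul_const μ).cexp
  have h2 := h1.smul (hasDerivAt_sum_pow_div_factorial_smul (fun k => ((f - μ • 1) ^ k) v) n s)
  refine h2.congr_deriv ?_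
  have hf : ∀ w, f w = (f - μ • 1) w + μ • w := fun w => by simp
  rw [mode, map_smul, hf, map_sum, smul_add]
  congr 1
  · congr 1
    rw [Finset.sum_range_succ, map_smul, ← Module.End.mul_apply, ← pow_succ', hv, smul_zero,
      add_zero]
    refine Finset.sum_congr rfl fun k _ => ?_
    rw [map_smul, ← Module.End.mul_apply, ← pow_succ']
  · rw [smul_smul]

theorem isLinearSolution_mode [Fintype ι] {f : Module.End ℂ (ι → ℂ)} {μ : ℂ} {n : ℕ} {v : ι → ℂ}
    (hv : ((f - μ • 1) ^ (n + 1)) v = 0) (a : ℝ) :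
    IsLinearSolution f a (fun t => mode f μ n v ((a * t : ℝ) : ℂ)) := fun t _ => by
  have h1 : HasDerivAt (fun t : ℝ => ((a * t : ℝ) : ℂ)) (a : ℂ) t := by
    have := ((hasDerivAt_id t).const_mul a).ofReal_comp
    simpa using this
  exact (HasDerivAt.scomp t (hasDerivAt_mode hv _) h1).hasDerivWithinAt

/-- The strict gap between `a * μ.re` and `c` absorbs the polynomial factor of the Jordan block. -/
theorem isBigO_mode [Fintype ι] (f : Module.End ℂ (ι → ℂ)) (μ : ℂ) (n : ℕ) (v : ι → ℂ) {a c : ℝ}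
    (hc : a * μ.re < c) :
    (fun t : ℝ => mode f μ n v ((a * t : ℝ) : ℂ)) =O[atTop] fun t => Real.exp (c * t) := by
  have h1 : (fun t : ℝ => Complex.exp (((a * t : ℝ) : ℂ) * μ)) =O[atTop]
      fun t => Real.exp (a * μ.re * t) := by
    refine IsBigO.of_bound 1 (Eventually.of_forall fun t => ?_)
    rw [Complex.norm_exp, Real.norm_of_nonneg (Real.exp_pos _).le, one_mul]
    simp only [Complex.mul_re, Complex.ofReal_re, Complex.ofReal_im, zero_mul, sub_zero]
    rw [mul_right_comm]
  have h2 : (fun t : ℝ => ∑ k ∈ Finset.range (n + 1), (((a * t : ℝ) : ℂ) ^ k / (k ! : ℂ)) •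
      ((f - μ • 1) ^ k) v) =O[atTop] fun t => Real.exp ((c - a * μ.re) * t) := by
    suffices h : ∀ k ∈ Finset.range (n + 1), (fun t : ℝ => (((a * t : ℝ) : ℂ) ^ k / (k ! : ℂ)) •
      ((f - μ • 1) ^ k) v) =O[atTop] fun t => Real.exp ((c - a * μ.re) * t) from IsBigO.fun_sum h
    intro k _
    have h3 : (fun t : ℝ => t ^ k) =O[atTop] fun t => Real.exp ((c - a * μ.re) * t) :=
      (isLittleO_pow_exp_pos_mul_atTop k (sub_pos.2 hc)).isBigO
    refine IsBigO.trans (g := fun t : ℝ => t ^ k) (IsBigO.of_bound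
      (|a| ^ k * ‖(k ! : ℂ)‖⁻¹ * ‖((f - μ • 1) ^ k) v‖) (Eventually.of_forall fun t => ?_)) h3
    rw [norm_smul, norm_div, norm_pow, Complex.norm_real, norm_mul, mul_pow, norm_pow,
      Real.norm_eq_abs a]
    exact le_of_eq (by ring)
  refine (h1.smul h2).trans (IsBigO.of_bound 1 (Eventually.of_forall fun t => ?_))
  rw [smul_eq_mul, ← Real.exp_add, one_mul]
  exact le_of_eq (by ring_nf)

/-- The last nonzero vector of the Jordan chain of `v` is an eigenvector and gives the limiting
direction of the mode. -/
theorem exists_last_pow_ne_zero {f : Module.End ℂ (ι → ℂ)} {μ : ℂ} {v : ι → ℂ}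
    (hv : v ∈ f.maxGenEigenspace μ) (h0 : v ≠ 0) :
    ∃ n : ℕ, ((f - μ • (1 : Module.End ℂ (ι → ℂ))) ^ (n + 1)) v = 0 ∧
      ((f - μ • (1 : Module.End ℂ (ι → ℂ))) ^ n) v ≠ 0 := by
  classical
  have h := (mem_maxGenEigenspace f μ v).1 hv
  have hpos : Nat.find h ≠ 0 := fun h1 => h0 (by simpa [h1] using Nat.find_spec h)
  obtain ⟨n, hn⟩ := Nat.exists_eq_succ_of_ne_zero hpos
  exact ⟨n, by simpa [hn] using Nat.find_spec h, Nat.find_min h (by omega)⟩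

theorem apply_eq_smul_of_pow_succ_apply_eq_zero {f : Module.End ℂ (ι → ℂ)} {μ : ℂ} {v : ι → ℂ}
    {n : ℕ} (hv : ((f - μ • 1) ^ (n + 1)) v = 0) :
    f (((f - μ • 1) ^ n) v) = μ • ((f - μ • 1) ^ n) v := by
  rw [pow_succ', Module.End.mul_apply] at hv
  simpa [sub_eq_zero] using hv

/-- Every vector in a sum of generalized eigenspaces is the initial value of a solution whose
growth is controlled by the eigenvalues involved. -/
theorem exists_isLinearSolution [Fintype ι] {f : Module.End ℂ (ι → ℂ)} {a c : ℝ} {P : ℂ → Prop}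
    (hP : ∀ μ, P μ → f.HasEigenvalue μ → a * μ.re < c) {v : ι → ℂ}
    (hv : v ∈ ⨆ (μ : ℂ) (_ : P μ), f.maxGenEigenspace μ) :
    ∃ y, y 0 = v ∧ IsLinearSolution f a y ∧ y =O[atTop] fun t => Real.exp (c * t) := by
  have hzero : ∃ y : ℝ → ι → ℂ, y 0 = 0 ∧ IsLinearSolution f a y ∧
      y =O[atTop] fun t => Real.exp (c * t) :=
    ⟨0, rfl, fun t _ => 
      (hasDerivWithinAt_const t (Set.Ici 0) (0 : ι → ℂ)).congr_deriv (by simp),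
      isBigO_zero _ _⟩
  rw [iSup_subtype'] at hv
  refine Submodule.iSup_induction _ (motive := fun v => ∃ y : ℝ → ι → ℂ, y 0 = v ∧
    IsLinearSolution f a y ∧ y =O[atTop] fun t => Real.exp (c * t)) hv ?_ hzero ?_
  · rintro ⟨μ, hμ⟩ v hv
    by_cases h0 : v = 0
    · exact h0 ▸ hzero
    · obtain ⟨n, hn, hn'⟩ := exists_last_pow_ne_zero hv h0
      have he : f.HasEigenvalue μ := hasEigenvalue_of_hasEigenvector
        ⟨mem_eigenspace_iff.2 (apply_eq_smul_of_pow_succ_apply_eq_zero hn), hn'⟩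
      exact ⟨_, by simp [mode_zero], isLinearSolution_mode hn a, isBigO_mode f μ n v (hP μ hμ he)⟩
  · rintro v w ⟨y, hy0, hy, hyO⟩ ⟨z, hz0, hz, hzO⟩
    exact ⟨y + z, by simp [hy0, hz0], hy.add hz, hyO.add hzO⟩

/-- Solutions grow at most like the exponential of any rate above all eigenvalues. -/
theorem IsLinearSolution.isBigO [Fintype ι] {f : Module.End ℂ (ι → ℂ)} {a c : ℝ} {y : ℝ → ι → ℂ}
    (hy : IsLinearSolution f a y) (hc : ∀ μ, f.HasEigenvalue μ → a * μ.re < c) :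
    y =O[atTop] fun t => Real.exp (c * t) := by
  have hv : y 0 ∈ ⨆ (μ : ℂ) (_ : True), f.maxGenEigenspace μ := by
    simp [iSup_maxGenEigenspace_eq_top]
  obtain ⟨z, hz0, hz, hzO⟩ := exists_isLinearSolution (fun μ _ h => hc μ h) hv
  refine hzO.congr' ?_ EventuallyEq.rfl
  filter_upwards [eventually_ge_atTop 0] with t ht
  exact hz.eq_of_eq_zero hy hz0 ht

theorem tendsto_inv_ofReal_mul_atTop (a : ℝ) :
    Tendsto (fun t : ℝ => (((a * t : ℝ) : ℂ))⁻¹) atTop (𝓝 0) := by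
  rw [tendsto_zero_iff_norm_tendsto_zero]
  have h : Tendsto (fun t : ℝ => |a|⁻¹ * |t|⁻¹) atTop (𝓝 (|a|⁻¹ * 0)) :=
    (tendsto_inv_atTop_zero.comp tendsto_abs_atTop_atTop).const_mul _
  rw [mul_zero] at h
  refine h.congr fun t => ?_
  rw [norm_inv, Complex.norm_real, Real.norm_eq_abs, abs_mul, mul_inv]

/-- After cancelling the exponential and dividing by the `n`-th power of time, only the top term of
the polynomial survives. -/
theorem tendsto_mode {f : Module.End ℂ (ι → ℂ)} {μ : ℂ} {n : ℕ} {v : ι → ℂ} {a : ℝ}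
    (ha : a ≠ 0) :
    Tendsto (fun t : ℝ => (((((a * t : ℝ) : ℂ))⁻¹) ^ n * Complex.exp (-(((a * t : ℝ) : ℂ) * μ))) •
      mode f μ n v ((a * t : ℝ) : ℂ)) atTop (𝓝 ((n ! : ℂ)⁻¹ • ((f - μ • 1) ^ n) v)) := by
  have h1 : Tendsto (fun t : ℝ => ∑ k ∈ Finset.range (n + 1),
      ((((((a * t : ℝ) : ℂ))⁻¹) ^ (n - k)) * (k ! : ℂ)⁻¹) • ((f - μ • 1) ^ k) v) atTop
      (𝓝 (∑ k ∈ Finset.range (n + 1), (((0 : ℂ) ^ (n - k)) * (k ! : ℂ)⁻¹) •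
        ((f - μ • 1) ^ k) v)) :=
    tendsto_finsetSum _ fun k _ =>
      (((tendsto_inv_ofReal_mul_atTop a).pow (n - k)).mul_const _).smul_const _
  have h2 : ∑ k ∈ Finset.range (n + 1), (((0 : ℂ) ^ (n - k)) * (k ! : ℂ)⁻¹) •
        ((f - μ • 1) ^ k) v = (n ! : ℂ)⁻¹ • ((f - μ • 1) ^ n) v := by
    rw [Finset.sum_range_succ, Finset.sum_eq_zero, zero_add]
    · simp
    · intro k hk
      rw [zero_pow (by have := Finset.mem_range.1 hk; omega), zero_mul, zero_smul]
  rw [h2] at h1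
  refine h1.congr' ?_
  filter_upwards [eventually_gt_atTop 0] with t ht
  have hx : ((a * t : ℝ) : ℂ) ≠ 0 := by exact_mod_cast mul_ne_zero ha ht.ne'
  generalize ((a * t : ℝ) : ℂ) = x at hx
  rw [mode, smul_smul, mul_assoc, ← Complex.exp_add, neg_add_cancel, Complex.exp_zero, mul_one,
    Finset.smul_sum]
  refine Finset.sum_congr rfl fun k hk => ?_
  rw [smul_smul]
  congr 1
  have hk : k ≤ n := by have := Finset.mem_range.1 hk; omega
  obtain ⟨m, rfl⟩ := Nat.exists_eq_add_of_le hk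
  have hxk : x⁻¹ ^ k * x ^ k = 1 := by rw [← mul_pow, inv_mul_cancel₀ hx, one_pow]
  rw [Nat.add_sub_cancel_left]
  linear_combination -(x⁻¹ ^ m * (k ! : ℂ)⁻¹) * hxk

/-- There are finitely many eigenvalues, so strict inequalities leave a uniform gap. -/
theorem exists_lt_of_forall_eigenvalue [Fintype ι] {f : Module.End ℂ (ι → ℂ)} {P : ℂ → Prop}
    {a b : ℝ} (hb : ∀ μ, f.HasEigenvalue μ → P μ → a * μ.re < b) :
    ∃ c < b, ∀ μ, f.HasEigenvalue μ → P μ → a * μ.re < c := by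
  have hfin : {μ : ℂ | f.HasEigenvalue μ}.Finite := f.finite_hasEigenvalue
  have : ∀ᶠ c in 𝓝[<] b, ∀ μ ∈ {μ : ℂ | f.HasEigenvalue μ}, P μ → a * μ.re < c :=
    hfin.eventually_all.2 fun μ hμ => by
      by_cases h : P μ
      · filter_upwards [Ioo_mem_nhdsLT (hb μ hμ h)] with c hc _ using hc.1
      · exact Eventually.of_forall fun _ h' => absurd h' h
  obtain ⟨c, hc, hlt⟩ := (this.and self_mem_nhdsWithin).exists
  exact ⟨c, hlt, hc⟩

/-- If `a r` is strictly larger than the real parts of all other eigenvalues of `a f`, then a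
solution of `y' = a f(y)` with a component in the generalized eigenspace of `r` asymptotically
points into the eigenspace of `r`, and grows at least like `e ^ (a r t)`. -/
theorem IsLinearSolution.dominant [Fintype ι] {f : Module.End ℂ (ι → ℂ)} {a r : ℝ} {y : ℝ → ι → ℂ}
    (ha : a ≠ 0) (hr : ∀ μ, f.HasEigenvalue μ → μ ≠ r → a * μ.re < a * r)
    (hy : IsLinearSolution f a y)
    (hv : y 0 ∉ ⨆ (μ : ℂ) (_ : μ ≠ (r : ℂ)), f.maxGenEigenspace μ) :
    (fun t => f (y t) - (r : ℂ) • y t) =o[atTop] y ∧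
      (fun t => Real.exp (a * r * t)) =O[atTop] y := by
  obtain ⟨c, hcr, hc⟩ := exists_lt_of_forall_eigenvalue hr
  have htop : y 0 ∈ f.maxGenEigenspace r ⊔ ⨆ (μ : ℂ) (_ : μ ≠ (r : ℂ)), f.maxGenEigenspace μ := by
    rw [← iSup_split_single, iSup_maxGenEigenspace_eq_top]
    trivial
  obtain ⟨p, hp, q, hq, hpq⟩ := Submodule.mem_sup.1 htop
  have hp0 : p ≠ 0 := fun h => hv (by rwa [← hpq, h, zero_add])
  obtain ⟨n, hn, hn'⟩ := exists_last_pow_ne_zero hp hp0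
  obtain ⟨yq, hyq0, hyq, hyqO⟩ := exists_isLinearSolution (a := a) (fun μ h h' => hc μ h' h) hq
  have hEq : y =ᶠ[atTop] fun t => mode f r n p ((a * t : ℝ) : ℂ) + yq t := by
    filter_upwards [eventually_ge_atTop 0] with t ht
    refine hy.eq_of_eq_zero ((isLinearSolution_mode hn a).add hyq) ?_ ht
    simp [mode_zero, hyq0, hpq]
  -- Rescaling by `d` makes the solution converge to the nonzero eigenvector `z`. Both claims are
  -- proved for `d • y`, whose norm is eventually bounded below, and then multiplied by `d⁻¹`.
  set d : ℝ → ℂ := fun t => ((((a * t : ℝ) : ℂ))⁻¹) ^ n * Complex.exp (-(((a * t : ℝ) : ℂ) * r))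
  set z : ι → ℂ := (n ! : ℂ)⁻¹ • ((f - (r : ℂ) • 1) ^ n) p
  have hz0 : z ≠ 0 := smul_ne_zero (inv_ne_zero (by exact_mod_cast n.factorial_ne_zero)) hn'
  have hfz : f z = (r : ℂ) • z := by
    rw [map_smul, apply_eq_smul_of_pow_succ_apply_eq_zero hn, smul_comm]
  have hpowO : (fun t : ℝ => ((((a * t : ℝ) : ℂ))⁻¹) ^ n) =O[atTop] fun _ => (1 : ℝ) :=
    ((tendsto_inv_ofReal_mul_atTop a).pow n).isBigO_one ℝ
  have hexpn : ∀ t : ℝ, ‖Complex.exp (-(((a * t : ℝ) : ℂ) * r))‖ = Real.exp (-(a * r * t)) := by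
    intro t
    rw [Complex.norm_exp]
    congr 1
    simp
    ring
  have hdq : Tendsto (fun t => d t • yq t) atTop (𝓝 0) := by
    have h1 : (fun t : ℝ => Complex.exp (-(((a * t : ℝ) : ℂ) * r))) =O[atTop]
        fun t => Real.exp (-(a * r * t)) :=
      IsBigO.of_bound 1 (Eventually.of_forall fun t => by
        rw [hexpn, Real.norm_of_nonneg (Real.exp_pos _).le, one_mul])
    refine ((hpowO.mul h1).smul hyqO).trans_tendsto ?_
    have h2 : Tendsto (fun t : ℝ => Real.exp (-((a * r - c) * t))) atTop (𝓝 0) :=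
      Real.tendsto_exp_neg_atTop_nhds_zero.comp
        (tendsto_id.const_mul_atTop (sub_pos.2 hcr))
    refine h2.congr fun t => ?_
    rw [smul_eq_mul, one_mul, ← Real.exp_add]
    ring_nf
  have hw : Tendsto (fun t => d t • y t) atTop (𝓝 z) := by
    have := (tendsto_mode (f := f) (μ := r) (n := n) (v := p) ha).add hdq
    rw [add_zero] at this
    refine this.congr' ?_
    filter_upwards [hEq] with t ht
    rw [ht, smul_add]
  have hone : (fun _ : ℝ => (1 : ℝ)) =O[atTop] fun t => d t • y t :=
    (isBigO_const_left_iff_pos_le_norm (one_ne_zero)).2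
      ⟨‖z‖ / 2, half_pos (norm_pos_iff.2 hz0),
        (hw.norm.eventually_const_lt (half_lt_self (norm_pos_iff.2 hz0))).mono fun _ h => h.le⟩
  have hdne : ∀ᶠ t in atTop, d t ≠ 0 := by
    filter_upwards [eventually_gt_atTop 0] with t ht
    have hx : ((a * t : ℝ) : ℂ) ≠ 0 := by exact_mod_cast mul_ne_zero ha ht.ne'
    exact mul_ne_zero (pow_ne_zero _ (inv_ne_zero hx)) (Complex.exp_ne_zero _)
  have hback : (fun t => (d t)⁻¹ • (d t • y t)) =ᶠ[atTop] y := by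
    filter_upwards [hdne] with t ht
    rw [smul_smul, inv_mul_cancel₀ ht, one_smul]
  constructor
  · have hcont : Continuous fun w : ι → ℂ => f w - (r : ℂ) • w :=
      (LinearMap.continuous_of_finiteDimensional f).sub (continuous_const_smul _)
    have h1 : Tendsto (fun t => f (d t • y t) - (r : ℂ) • (d t • y t)) atTop (𝓝 0) := by
      have := (hcont.tendsto z).comp hw
      rwa [hfz, sub_self] at this
    have h2 := ((isLittleO_one_iff ℝ).2 h1).trans_isBigO hone
    have h3 := (isBigO_refl (fun t => (d t)⁻¹) atTop).smul_isLittleO h2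
    refine h3.congr' ?_ hback
    filter_upwards [hdne] with t ht
    rw [map_smul, smul_comm (r : ℂ), ← smul_sub, smul_smul, inv_mul_cancel₀ ht, one_smul]
  -- Multiplying the bounded factor `(a t)⁻ⁿ` by `d⁻¹` leaves exactly the exponential.
  · have h1 := (isBigO_refl (fun t => (d t)⁻¹) atTop).smul (hpowO.trans hone)
    refine (IsBigO.of_norm_left ?_)
    refine (h1.norm_left.congr' ?_ hback)
    filter_upwards [eventually_gt_atTop 0] with t ht
    have hx : ((a * t : ℝ) : ℂ) ≠ 0 := by exact_mod_cast mul_ne_zero ha ht.ne'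
    rw [smul_eq_mul, mul_inv, mul_right_comm, inv_mul_cancel₀ (pow_ne_zero _ (inv_ne_zero hx)),
      one_mul, norm_inv, hexpn, ← Real.exp_neg, neg_neg, Real.norm_of_nonneg (Real.exp_pos _).le]

end LinearODE

end FracGraph

end

/-! ### Dirichlet energy as a quadratic form, and spectra of `L`, `I - L` and `W`. -/

noncomputable section

namespace FracGraph

open Matrix

theorem sna_apply {N : ℕ} (G : Digraph (Fin N)) (i j : Fin N) :
    sna G i j = (√(inDeg G i))⁻¹ * adj G i j * (√(outDeg G j))⁻¹ := by
  rw [sna, mul_diagonal, diagonal_mul]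

theorem adj_nonneg {N : ℕ} (G : Digraph (Fin N)) (i j : Fin N) : 0 ≤ adj G i j := by
  simp only [adj, of_apply]
  split_ifs <;> norm_num

theorem sna_nonneg {N : ℕ} (G : Digraph (Fin N)) (i j : Fin N) : 0 ≤ sna G i j := by
  rw [sna_apply]
  have := adj_nonneg G i j
  positivity

/-- In a strongly connected digraph with at least one edge all degrees are positive. -/
theorem sna_eq_zero_or_degrees_pos {N : ℕ} {G : Digraph (Fin N)} (hG : StronglyConnected G) :
    sna G = 0 ∨ ∀ i, 0 < inDeg G i ∧ 0 < outDeg G i := by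
  by_cases h : ∃ a b, G.Adj a b
  · right
    obtain ⟨a, b, hab⟩ := h
    intro i
    constructor
    · obtain ⟨j, hj⟩ : ∃ j, G.Adj j i := by
        rcases Relation.ReflTransGen.cases_tail (hG b i) with h | ⟨c, _, hc⟩
        · exact ⟨a, h ▸ hab⟩
        · exact ⟨c, hc⟩
      refine Finset.sum_pos' (fun k _ => adj_nonneg G i k) ⟨j, Finset.mem_univ _, ?_⟩
      simp [adj, hj]
    · obtain ⟨j, hj⟩ : ∃ j, G.Adj i j := by
        rcases Relation.ReflTransGen.cases_head (hG i a) with h | ⟨c, hc, _⟩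
        · exact ⟨b, h ▸ hab⟩
        · exact ⟨c, hc⟩
      refine Finset.sum_pos' (fun k _ => adj_nonneg G k i) ⟨j, Finset.mem_univ _, ?_⟩
      simp [adj, hj]
  · left
    push Not at h
    ext i j
    rw [sna_apply]
    simp [adj, h]

theorem trace_sna_eq_zero {N : ℕ} {G : Digraph (Fin N)} (hG : ∀ i, ¬ G.Adj i i) :
    (sna G).trace = 0 :=
  Finset.sum_eq_zero fun i _ => by simp [sna_apply, adj, hG i]

theorem frob_sq {N K : ℕ} (x : Matrix (Fin N) (Fin K) ℝ) :
    frob x ^ 2 = ∑ i, ∑ k, x i k ^ 2 :=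
  Real.sq_sqrt (Finset.sum_nonneg fun _ _ => Finset.sum_nonneg fun _ _ => sq_nonneg _)

theorem abs_le_frob {N K : ℕ} (x : Matrix (Fin N) (Fin K) ℝ) (i : Fin N) (k : Fin K) :
    |x i k| ≤ frob x := by
  refine Real.abs_le_sqrt ?_
  refine (Finset.single_le_sum (f := fun k => x i k ^ 2) (fun _ _ => sq_nonneg _)
    (Finset.mem_univ k)).trans ?_
  exact Finset.single_le_sum (f := fun i => ∑ k, x i k ^ 2)
    (fun _ _ => Finset.sum_nonneg fun _ _ => sq_nonneg _) (Finset.mem_univ i)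

theorem dirichletEnergy_smul {N K : ℕ} (G : Digraph (Fin N)) (c : ℝ)
    (x : Matrix (Fin N) (Fin K) ℝ) :
    dirichletEnergy G (c • x) = c ^ 2 * dirichletEnergy G x := by
  simp only [dirichletEnergy, Matrix.smul_apply, smul_eq_mul, Finset.mul_sum]
  refine Finset.sum_congr rfl fun i _ => Finset.sum_congr rfl fun j _ =>
    Finset.sum_congr rfl fun k _ => ?_
  ring

/-- Expanding the square, row sums of `A` cancel the in-degrees and column sums the out-degrees, so
each square term sums to `‖x‖²`; the cross term is `⟨x, L x⟩`. Positive degrees are what make the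
cancellation valid. -/
theorem dirichletEnergy_eq {N K : ℕ} {G : Digraph (Fin N)}
    (hdeg : ∀ i, 0 < inDeg G i ∧ 0 < outDeg G i) (x : Matrix (Fin N) (Fin K) ℝ) :
    dirichletEnergy G x = 1 / 2 * (frob x ^ 2 - ∑ i, ∑ k, x i k * (sna G * x) i k) := by
  have hterm : ∀ i j k, adj G i j * (x i k / √(inDeg G i) - x j k / √(outDeg G j)) ^ 2 =
      adj G i j * (x i k ^ 2 / inDeg G i) + adj G i j * (x j k ^ 2 / outDeg G j)
        - 2 * (x i k * (sna G i j * x j k)) := by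
    intro i j k
    rw [sna_apply, sub_sq, div_pow, div_pow, Real.sq_sqrt (hdeg i).1.le,
      Real.sq_sqrt (hdeg j).2.le]
    ring
  have h1 : ∑ i, ∑ j, ∑ k, adj G i j * (x i k ^ 2 / inDeg G i) = frob x ^ 2 := by
    rw [frob_sq]
    refine Finset.sum_congr rfl fun i _ => ?_
    rw [Finset.sum_comm]
    refine Finset.sum_congr rfl fun k _ => ?_
    rw [← Finset.sum_mul]
    exact mul_div_cancel₀ _ (hdeg i).1.ne'
  have h2 : ∑ i, ∑ j, ∑ k, adj G i j * (x j k ^ 2 / outDeg G j) = frob x ^ 2 := by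
    rw [frob_sq, Finset.sum_comm]
    refine Finset.sum_congr rfl fun j _ => ?_
    rw [Finset.sum_comm]
    refine Finset.sum_congr rfl fun k _ => ?_
    rw [← Finset.sum_mul]
    exact mul_div_cancel₀ _ (hdeg j).2.ne'
  have h3 : ∑ i, ∑ j, ∑ k, 2 * (x i k * (sna G i j * x j k)) =
      2 * ∑ i, ∑ k, x i k * (sna G * x) i k := by
    rw [Finset.mul_sum]
    refine Finset.sum_congr rfl fun i _ => ?_
    rw [Finset.sum_comm, Finset.mul_sum]
    refine Finset.sum_congr rfl fun k _ => ?_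
    rw [mul_apply, Finset.mul_sum, Finset.mul_sum]
  simp only [dirichletEnergy, Finset.mul_sum (s := Finset.univ (α := Fin K)), hterm,
    Finset.sum_add_distrib, Finset.sum_sub_distrib, h1, h2, h3]
  ring

/-- Isolates the deviation from `(1 - r) / 2` as a term linear in the residual `L x - r x`. -/
theorem dirichletEnergy_normalized {N K : ℕ} {G : Digraph (Fin N)}
    (hdeg : ∀ i, 0 < inDeg G i ∧ 0 < outDeg G i) {x : Matrix (Fin N) (Fin K) ℝ}
    (hx : frob x ≠ 0) (r : ℝ) :
    dirichletEnergy G (normalized x) = (1 - r) / 2 -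
      (∑ i, ∑ k, x i k * ((sna G * x) i k - r * x i k)) / frob x ^ 2 / 2 := by
  have h : ∑ i, ∑ k, x i k * ((sna G * x) i k - r * x i k) =
      ∑ i, ∑ k, x i k * (sna G * x) i k - r * frob x ^ 2 := by
    rw [frob_sq, Finset.mul_sum, ← Finset.sum_sub_distrib]
    refine Finset.sum_congr rfl fun i _ => ?_
    rw [Finset.mul_sum, ← Finset.sum_sub_distrib]
    exact Finset.sum_congr rfl fun k _ => by ring
  rw [normalized, dirichletEnergy_smul, dirichletEnergy_eq hdeg, h]
  field_simp
  ring

/-- If the columns of `x` become approximate eigenvectors for `r`, the normalized energy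
tends to `(1 - r) / 2`. -/
theorem isFreqDominant_of_isLittleO {N K : ℕ} {G : Digraph (Fin N)}
    (hdeg : ∀ i, 0 < inDeg G i ∧ 0 < outDeg G i) {x : ℝ → Matrix (Fin N) (Fin K) ℝ} {r : ℝ}
    (h0 : ∀ᶠ t in atTop, frob (x t) ≠ 0)
    (h : ∀ i k, (fun t => (sna G * x t) i k - r * x t i k) =o[atTop] fun t => frob (x t)) :
    IsFreqDominant G x (1 - r) := by
  have h1 : (fun t => ∑ i, ∑ k, x t i k * ((sna G * x t) i k - r * x t i k)) =o[atTop]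
      fun t => frob (x t) ^ 2 := by
    suffices h : ∀ i k, (fun t => x t i k * ((sna G * x t) i k - r * x t i k)) =o[atTop]
        fun t => frob (x t) ^ 2 from
      Asymptotics.IsLittleO.fun_sum fun i _ => Asymptotics.IsLittleO.fun_sum fun k _ => h i k
    intro i k
    have h2 : (fun t => x t i k) =O[atTop] fun t => frob (x t) :=
      Asymptotics.IsBigO.of_bound 1 (Eventually.of_forall fun t => by
        rw [one_mul]
        exact (abs_le_frob (x t) i k).trans (le_abs_self _))
    simpa only [sq] using h2.mul_isLittleO (h i k)
  have h3 := (h1.tendsto_div_nhds_zero.div_const 2).const_sub ((1 - r) / 2)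
  rw [zero_div, sub_zero] at h3
  refine h3.congr' ?_
  filter_upwards [h0] with t ht
  exact (dirichletEnergy_normalized hdeg ht r).symm

theorem mem_eigenvalues_snl {N : ℕ} (G : Digraph (Fin N)) (μ : ℂ) :
    μ ∈ eigenvalues (snl G) ↔ 1 - μ ∈ eigenvalues (sna G) := by
  have h : (snl G).map (fun a : ℝ => (a : ℂ)) = 1 - (sna G).map (fun a : ℝ => (a : ℂ)) := by
    ext i j
    by_cases hij : i = j <;> simp [snl, one_apply, hij]
  rw [eigenvalues, eigenvalues, h, spectrum.mem_iff, spectrum.mem_iff, ← IsUnit.neg_iff]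
  rw [map_sub, map_one]
  congr! 2
  abel

theorem IsLowestEigenvalue.one_sub {N : ℕ} {G : Digraph (Fin N)} {l : ℂ}
    (h : IsLowestEigenvalue (sna G) l) : IsHighestEigenvalue (snl G) (1 - l) := by
  refine ⟨(mem_eigenvalues_snl G _).2 (by rw [sub_sub_cancel]; exact h.1), fun m hm => ?_⟩
  have := h.2 _ ((mem_eigenvalues_snl G _).1 hm)
  simp only [Complex.sub_re, Complex.one_re] at this ⊢
  linarith

theorem IsHighestEigenvalue.one_sub {N : ℕ} {G : Digraph (Fin N)} {l : ℂ}
    (h : IsHighestEigenvalue (sna G) l) : IsLowestEigenvalue (snl G) (1 - l) := by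
  refine ⟨(mem_eigenvalues_snl G _).2 (by rw [sub_sub_cancel]; exact h.1), fun m hm => ?_⟩
  have := h.2 _ ((mem_eigenvalues_snl G _).1 hm)
  simp only [Complex.sub_re, Complex.one_re] at this ⊢
  linarith

/-- The characteristic polynomial has real coefficients. Hence an eigenvalue that is alone with its
real part is real. -/
theorem conj_mem_eigenvalues {n : ℕ} {M : Matrix (Fin n) (Fin n) ℝ} {l : ℂ}
    (hl : l ∈ eigenvalues M) : (starRingEnd ℂ) l ∈ eigenvalues M := by
  have h : ∀ z : ℂ, z ∈ eigenvalues M ↔ Polynomial.aeval z M.charpoly = 0 := fun z => by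
    have := Matrix.charpoly_map M Complex.ofRealHom
    rw [eigenvalues, Matrix.mem_spectrum_iff_isRoot_charpoly, Polynomial.aeval_def,
      Polynomial.eval₂_eq_eval_map, Polynomial.IsRoot.def]
    exact this ▸ Iff.rfl
  rw [h] at hl ⊢
  rw [Polynomial.aeval_conj, hl, map_zero]

theorem eigenvalues_diagonal {n : ℕ} (w : Fin n → ℝ) :
    eigenvalues (diagonal w) = Set.range fun k => (w k : ℂ) := by
  rw [eigenvalues, diagonal_map Complex.ofReal_zero, spectrum_diagonal]

theorem IsLowestEigenvalue.exists_eq_diagonal {n : ℕ} {w : Fin n → ℝ} {a : ℝ}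
    (h : IsLowestEigenvalue (diagonal w) (a : ℂ)) : (∃ k, w k = a) ∧ ∀ k, a ≤ w k := by
  rw [IsLowestEigenvalue, eigenvalues_diagonal] at h
  obtain ⟨⟨k, hk⟩, h2⟩ := h
  exact ⟨⟨k, by simpa using hk⟩, fun k => by simpa using h2 _ ⟨k, rfl⟩⟩

theorem IsHighestEigenvalue.exists_eq_diagonal {n : ℕ} {w : Fin n → ℝ} {a : ℝ}
    (h : IsHighestEigenvalue (diagonal w) (a : ℂ)) : (∃ k, w k = a) ∧ ∀ k, w k ≤ a := by
  rw [IsHighestEigenvalue, eigenvalues_diagonal] at h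
  obtain ⟨⟨k, hk⟩, h2⟩ := h
  exact ⟨⟨k, by simpa using hk⟩, fun k => by simpa using h2 _ ⟨k, rfl⟩⟩

end FracGraph

end

/-! ### The heat equation column by column, for generic initial values. -/

noncomputable section

namespace FracGraph

open Matrix Asymptotics Module.End

/-- The symmetrically normalized adjacency acting on complex vectors. -/
def snaEnd {N : ℕ} (G : Digraph (Fin N)) : Module.End ℂ (Fin N → ℂ) :=
  Matrix.toLin' ((sna G).map (fun a : ℝ => (a : ℂ)))

theorem hasEigenvalue_snaEnd {N : ℕ} (G : Digraph (Fin N)) (μ : ℂ) :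
    (snaEnd G).HasEigenvalue μ ↔ μ ∈ eigenvalues (sna G) := by
  rw [Module.End.hasEigenvalue_iff_mem_spectrum, snaEnd, Matrix.spectrum_toLin', eigenvalues]

/-- The `k`-th column of `x` as a complex vector. -/
def complexCol {N K : ℕ} (k : Fin K) : (Fin N → Fin K → ℝ) →ₗ[ℝ] (Fin N → ℂ) where
  toFun x := fun i => (x i k : ℂ)
  map_add' x y := by
    ext i
    simp
  map_smul' c x := by
    ext i
    simp

theorem snaEnd_complexCol {N K : ℕ} (G : Digraph (Fin N)) (x : Matrix (Fin N) (Fin K) ℝ)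
    (k : Fin K) (i : Fin N) : snaEnd G (complexCol k x) i = ((sna G * x) i k : ℂ) := by
  simp [snaEnd, complexCol, mulVec, dotProduct, Matrix.mul_apply]

theorem IsHeatSolution.isLinearSolution {N K : ℕ} {G : Digraph (Fin N)} {w : Fin K → ℝ}
    {x₀ : Matrix (Fin N) (Fin K) ℝ} {x : ℝ → Matrix (Fin N) (Fin K) ℝ}
    (hx : IsHeatSolution G (diagonal w) x₀ x) (k : Fin K) :
    IsLinearSolution (snaEnd G) (-w k) (fun t => complexCol k (x t)) := fun t ht => by
  refine hasDerivWithinAt_pi.2 fun i => ?_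
  have h := Complex.ofRealCLM.hasFDerivAt.comp_hasDerivWithinAt t (hx.2 t ht i k)
  refine h.congr_deriv ?_
  rw [Pi.smul_apply, snaEnd_complexCol, neg_apply, mul_diagonal]
  simp only [Complex.ofRealCLM_apply, smul_eq_mul]
  push_cast
  ring

/-- As `L` and `w` are real, taking real parts of complex solutions commutes with the equation. -/
theorem isHeatSolution_of_isLinearSolution {N K : ℕ} {G : Digraph (Fin N)} {w : Fin K → ℝ}
    {x₀ : Matrix (Fin N) (Fin K) ℝ} {y : Fin K → ℝ → Fin N → ℂ}
    (h0 : ∀ k, y k 0 = complexCol k x₀) (hy : ∀ k, IsLinearSolution (snaEnd G) (-w k) (y k)) :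
    IsHeatSolution G (diagonal w) x₀ (fun t => Matrix.of fun i k => (y k t i).re) := by
  refine ⟨?_, fun t ht i k => ?_⟩
  · ext i k
    simp [h0, complexCol]
  · have h := Complex.reCLM.hasFDerivAt.comp_hasDerivWithinAt t
      (hasDerivWithinAt_pi.1 (hy k t ht) i)
    refine h.congr_deriv ?_
    rw [neg_apply, mul_diagonal, Matrix.mul_apply]
    simp [snaEnd, mulVec, dotProduct, Finset.mul_sum, mul_left_comm, mul_comm]

theorem exists_isHeatSolution {N K : ℕ} (G : Digraph (Fin N)) (w : Fin K → ℝ)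
    (x₀ : Matrix (Fin N) (Fin K) ℝ) : ∃ x, IsHeatSolution G (diagonal w) x₀ x := by
  have : ∀ k, ∃ y : ℝ → Fin N → ℂ, y 0 = complexCol k x₀ ∧
      IsLinearSolution (snaEnd G) (-w k) y := fun k => by
    obtain ⟨c, hc⟩ : ∃ c, ∀ μ ∈ {μ : ℂ | (snaEnd G).HasEigenvalue μ}, -w k * μ.re < c :=
      (((snaEnd G).finite_hasEigenvalue.eventually_all (l := atTop)).2 fun μ _ =>
        eventually_gt_atTop (-w k * μ.re)).exists
    obtain ⟨y, h0, hy, -⟩ := exists_isLinearSolution (f := snaEnd G) (P := fun _ => True)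
      (fun μ _ h => hc μ h) (v := complexCol k x₀) (by simp [iSup_maxGenEigenspace_eq_top])
    exact ⟨y, h0, hy⟩
  choose y h0 hy using this
  exact ⟨_, isHeatSolution_of_isLinearSolution h0 hy⟩

/-- The `k`-th column of almost every real matrix has a nonzero component in the generalized eigenspace
of a given eigenvalue. -/
theorem ae_complexCol_notMem {N K : ℕ} {f : Module.End ℂ (Fin N → ℂ)} {r : ℂ}
    (hr : f.HasEigenvalue r) (k : Fin K) :
    ∀ᵐ x₀ : Fin N → Fin K → ℝ,
      complexCol k x₀ ∉ ⨆ (μ : ℂ) (_ : μ ≠ r), f.maxGenEigenspace μ := by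
  set S := ⨆ (μ : ℂ) (_ : μ ≠ r), f.maxGenEigenspace μ
  have hrow : (volume : Measure (Fin K → ℝ)).IsAddHaarMeasure := inferInstance
  have hvol : (volume : Measure (Fin N → Fin K → ℝ)).IsAddHaarMeasure :=
    Measure.pi.isAddHaarMeasure (fun _ : Fin N => (volume : Measure (Fin K → ℝ)))
  suffices h : (S.restrictScalars ℝ).comap (complexCol k) ≠ ⊤ by
    have h0 := Measure.addHaar_submodule volume _ h
    rw [ae_iff]
    simp only [not_not]
    exact h0
  intro h
  -- Columns of real matrices include the standard basis, which spans over `ℂ`. So `S` would be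
  -- everything, yet it is disjoint from the nonzero generalized eigenspace of `r`.
  have hS : S = ⊤ := by
    refine eq_top_iff.2 fun v _ => ?_
    have hsingle : ∀ i, (Pi.single i 1 : Fin N → ℂ) ∈ S := fun i => by
      have : (fun j _ => if j = i then 1 else 0 : Fin N → Fin K → ℝ) ∈
          (S.restrictScalars ℝ).comap (complexCol k) := h ▸ Submodule.mem_top
      have he : complexCol k (fun j _ => if j = i then 1 else 0 : Fin N → Fin K → ℝ) =
          Pi.single i 1 := by
        ext j
        by_cases hj : j = i <;> simp [complexCol, hj]
      exact he ▸ Submodule.mem_comap.1 this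
    rw [pi_eq_sum_univ' v]
    refine Submodule.sum_mem _ fun i _ => S.smul_mem _ ?_
    convert hsingle i using 1
  have hdisj : Disjoint (f.maxGenEigenspace r) S := f.independent_maxGenEigenspace r
  rw [hS, disjoint_top] at hdisj
  obtain ⟨u, hu⟩ := hr.exists_hasEigenvector
  have hmem : u ∈ f.maxGenEigenspace r := (mem_maxGenEigenspace f r u).2 ⟨1, by
    simp [hu.apply_eq_smul]⟩
  exact hu.2 (by simpa [hdisj] using hmem)

/-- If in the distinguished columns the eigenvalue `r` of `L` strictly dominates, and all other
columns grow slower than one distinguished column, then almost every initial value leads to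
`(1 - r)`-frequency-dominance. -/
theorem ae_isFreqDominant {N K : ℕ} {G : Digraph (Fin N)} {w : Fin K → ℝ} {r : ℝ}
    (hdeg : ∀ i, 0 < inDeg G i ∧ 0 < outDeg G i) (hr : (r : ℂ) ∈ eigenvalues (sna G))
    (good : Fin K → Prop) {k₀ : Fin K} (hk₀ : good k₀) (hw : ∀ k, good k → w k ≠ 0)
    (hgood : ∀ k, good k → ∀ μ ∈ eigenvalues (sna G), μ ≠ r → -w k * μ.re < -w k * r)
    (hbad : ∀ k, ¬ good k → ∀ μ ∈ eigenvalues (sna G), -w k * μ.re < -w k₀ * r) :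
    ∀ᵐ x₀ : Fin N → Fin K → ℝ,
      (∃ x, IsHeatSolution G (diagonal w) (Matrix.of x₀) x) ∧
      ∀ x, IsHeatSolution G (diagonal w) (Matrix.of x₀) x → IsFreqDominant G x (1 - r) := by
  simp only [← hasEigenvalue_snaEnd] at hr hgood hbad
  filter_upwards [ae_all_iff.2 fun k => ae_complexCol_notMem (N := N) (K := K) hr k] with x₀ hx₀
  refine ⟨exists_isHeatSolution G w _, fun x hx => ?_⟩
  have hdom : ∀ k, good k →
      (fun t => snaEnd G (complexCol k (x t)) - (r : ℂ) • complexCol k (x t)) =o[atTop]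
        (fun t => complexCol k (x t)) ∧
      (fun t => Real.exp (-w k * r * t)) =O[atTop] fun t => complexCol k (x t) := fun k hk =>
    (hx.isLinearSolution k).dominant (neg_ne_zero.2 (hw k hk)) (hgood k hk) (by
      rw [hx.1]
      exact hx₀ k)
  have hfrob : ∀ k, (fun t => complexCol k (x t)) =O[atTop] fun t => frob (x t) := fun k =>
    IsBigO.of_bound 1 (Eventually.of_forall fun t => by
      rw [one_mul, pi_norm_le_iff_of_nonneg (norm_nonneg _)]
      intro i
      have : ‖complexCol k (x t) i‖ = |x t i k| := Complex.norm_real _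
      rw [this]
      exact (abs_le_frob (x t) i k).trans (le_abs_self _))
  have hexp : (fun t => Real.exp (-w k₀ * r * t)) =O[atTop] fun t => frob (x t) :=
    (hdom k₀ hk₀).2.trans (hfrob k₀)
  refine isFreqDominant_of_isLittleO hdeg ?_ fun i k => ?_
  · filter_upwards [hexp.eq_zero_imp] with t ht h0
    exact (Real.exp_pos _).ne' (ht h0)
  · have hcol : (fun t => snaEnd G (complexCol k (x t)) - (r : ℂ) • complexCol k (x t)) =o[atTop]
        fun t => frob (x t) := by
      -- A good column has a residual small against itself; a bad column is itself small against
      -- column `k₀`.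
      by_cases hk : good k
      · exact (hdom k hk).1.trans_isBigO (hfrob k)
      · obtain ⟨c, hc, hlt⟩ := exists_lt_of_forall_eigenvalue (P := fun _ => True)
          (fun μ h _ => hbad k hk μ h)
        have h1 := (hx.isLinearSolution k).isBigO fun μ h => hlt μ h trivial
        have h2 : (fun t => Real.exp (c * t)) =o[atTop] fun t => Real.exp (-w k₀ * r * t) := by
          rw [Real.isLittleO_exp_comp_exp_comp]
          refine (tendsto_id.const_mul_atTop (sub_pos.2 hc)).congr fun t => ?_
          simp only [id]
          ring
        set F : (Fin N → ℂ) →L[ℂ] (Fin N → ℂ) :=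
          LinearMap.toContinuousLinearMap (snaEnd G - (r : ℂ) • 1)
        have h3 : (fun t => F (complexCol k (x t))) =O[atTop] fun t => complexCol k (x t) :=
          F.isBigO_comp _ _
        exact ((h3.trans h1).trans_isLittleO h2).trans_isBigO hexp
    refine IsLittleO.of_norm_left (IsBigO.trans_isLittleO (IsBigO.of_bound 1
      (Eventually.of_forall fun t => ?_)) hcol)
    rw [norm_norm, one_mul]
    refine le_trans (le_of_eq ?_)
      (norm_le_pi_norm (snaEnd G (complexCol k (x t)) - (r : ℂ) • complexCol k (x t)) i)
    rw [Pi.sub_apply, snaEnd_complexCol, Pi.smul_apply, ← Complex.norm_real]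
    congr 1
    simp [complexCol]

end FracGraph

end

/-! ### Which columns and which eigenvalue dominate. -/

theorem theorem5p5 (N K : ℕ) [NeZero N] [NeZero K] (G : Digraph (Fin N))
    (hG : FracGraph.StronglyConnected G)
    (W : Matrix (Fin K) (Fin K) ℝ) (hW : W.IsDiag)
    -- `l1`, `lN` are `λ₁(L)`, `λ_N(L)`, and `w1`, `wK` are `λ₁(W)`, `λ_K(W)`
    (l1 lN : ℂ)
    (hl1 : FracGraph.IsLowestEigenvalue (FracGraph.sna G) l1)
    (hlN : FracGraph.IsHighestEigenvalue (FracGraph.sna G) lN)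
    (w1 wK : ℝ)
    (hw1 : FracGraph.IsLowestEigenvalue W (w1 : ℂ))
    (hwK : FracGraph.IsHighestEigenvalue W (wK : ℂ)) :
    lN.im = 0 ∧
    ((∀ μ ∈ FracGraph.eigenvalues (FracGraph.sna G), μ.re = l1.re → μ = l1) →
      wK * l1.re < w1 * lN.re →
      ∀ᵐ x₀ : Fin N → Fin K → ℝ,
        (∃ x, FracGraph.IsHeatSolution G W (Matrix.of x₀) x) ∧
        ∀ x, FracGraph.IsHeatSolution G W (Matrix.of x₀) x → FracGraph.IsHFD G x) ∧
    (((∀ i, ¬ G.Adj i i) ∨ l1.re ≤ 0) →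
      w1 * lN.re < wK * l1.re →
      ∀ᵐ x₀ : Fin N → Fin K → ℝ,
        (∃ x, FracGraph.IsHeatSolution G W (Matrix.of x₀) x) ∧
        ∀ x, FracGraph.IsHeatSolution G W (Matrix.of x₀) x → FracGraph.IsLFD G x) := by
  obtain ⟨w, rfl⟩ : ∃ w, W = Matrix.diagonal w := ⟨W.diag, hW.diagonal_diag.symm⟩
  obtain ⟨⟨k1, hk1⟩, hwmin⟩ := hw1.exists_eq_diagonal
  obtain ⟨⟨kK, hkK⟩, hwmax⟩ := hwK.exists_eq_diagonal
  obtain ⟨hlNim, hlN0, hlNuniq⟩ :=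
    FracGraph.highest_eq_of_nonneg (FracGraph.sna_nonneg G) hlN
  have h1N : l1.re ≤ lN.re := hlN.2 l1 hl1.1
  have hwle : w1 ≤ wK := hk1 ▸ hwmax k1
  -- Excludes the edgeless case `L = 0`, in which both sides of the strict inequalities vanish.
  have hdeg : l1.re ≠ 0 ∨ lN.re ≠ 0 → ∀ i, 0 < FracGraph.inDeg G i ∧ 0 < FracGraph.outDeg G i := by
    intro h
    refine (FracGraph.sna_eq_zero_or_degrees_pos hG).resolve_left fun h0 => ?_
    have hz : ∀ μ ∈ FracGraph.eigenvalues (FracGraph.sna G), μ = 0 := fun μ hμ => by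
      rw [h0, FracGraph.eigenvalues, Matrix.map_zero _ Complex.ofReal_zero,
        spectrum.zero_eq] at hμ
      exact hμ
    rw [hz _ hl1.1, hz _ hlN.1] at h
    simp at h
  refine ⟨hlNim, fun huniq hlt => ?_, fun hloop hlt => ?_⟩
  · have hreal : ((l1.re : ℝ) : ℂ) = l1 := by
      have := huniq _ (FracGraph.conj_mem_eigenvalues hl1.1) (Complex.conj_re l1)
      exact Complex.conj_eq_iff_re.1 this
    -- Otherwise `wK * l1.re ≥ wK * lN.re ≥ w1 * lN.re`.
    have hwK : 0 < wK := by
      by_contra! h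
      nlinarith [mul_le_mul_of_nonpos_left h1N h]
    have hdeg := hdeg (by
      by_contra! h
      simp [h.1, h.2] at hlt)
    refine (FracGraph.ae_isFreqDominant (w := w) (r := l1.re) hdeg (by
      rw [hreal]; exact hl1.1) (fun k => 0 < w k) (k₀ := kK) (by rwa [hkK])
      (fun k hk => hk.ne') (fun k hk μ hμ hne => ?_) (fun k hk μ hμ => ?_)).mono fun x₀ hx₀ =>
      ⟨hx₀.1, fun x hx => ⟨1 - l1, hl1.one_sub, by simpa using hx₀.2 x hx⟩⟩
    · have hlt : l1.re < μ.re := lt_of_le_of_ne (hl1.2 μ hμ) fun h =>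
        hne (by rw [hreal]; exact huniq μ hμ h.symm)
      nlinarith
    -- For `w k ≤ 0`: `-w k * μ.re ≤ -w k * lN.re ≤ -w1 * lN.re < -wK * l1.re`, using `lN.re ≥ 0`.
    · rw [hkK]
      have h1 := hlN.2 μ hμ
      have h2 := hwmin k
      nlinarith [mul_le_mul_of_nonpos_left h1 (not_lt.1 hk), mul_le_mul_of_nonneg_right h2 hlN0]
  · have hl1n : l1.re ≤ 0 := hloop.elim
      (fun h => FracGraph.lowest_re_nonpos_of_trace_eq_zero (FracGraph.trace_sna_eq_zero h) hl1) id
    have hreal : ((lN.re : ℝ) : ℂ) = lN := Complex.ext (by simp) (by simp [hlNim])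
    -- Otherwise `w1 * lN.re ≥ 0 ≥ wK * l1.re`.
    have hw1 : w1 < 0 := by
      by_contra! h
      nlinarith [mul_nonneg h hlN0, mul_nonneg (h.trans hwle) (neg_nonneg.2 hl1n)]
    have hdeg := hdeg (by
      by_contra! h
      simp [h.1, h.2] at hlt)
    refine (FracGraph.ae_isFreqDominant (w := w) (r := lN.re) hdeg (by
      rw [hreal]; exact hlN.1) (fun k => w k < 0) (k₀ := k1) (by rwa [hk1])
      (fun k hk => hk.ne) (fun k hk μ hμ hne => ?_) (fun k hk μ hμ => ?_)).mono fun x₀ hx₀ =>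
      ⟨hx₀.1, fun x hx => ⟨1 - lN, hlN.one_sub, by simpa using hx₀.2 x hx⟩⟩
    · have hlt : μ.re < lN.re := lt_of_le_of_ne (hlN.2 μ hμ) fun h =>
        hne (by rw [hreal]; exact hlNuniq μ hμ h)
      nlinarith
    -- For `w k ≥ 0`: `-w k * μ.re ≤ -w k * l1.re ≤ -wK * l1.re < -w1 * lN.re`; the middle step is
    -- where `l1.re ≤ 0` enters.
    · rw [hk1]
      have h1 := hl1.2 μ hμ
      have h2 := hwmax k
      nlinarith [mul_le_mul_of_nonneg_left h1 (not_lt.1 hk), mul_le_mul_of_nonpos_right h2 hl1n]
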